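/- Let $K$ be an algebraically closed field of characteristic $p\ge 0$, let $k,n\ge 2$ be integers with $k$ relatively prime to $p$ if $p>0$, and let $\lambda_1,\dots,\lambda_{n-2}\in K\setminus\{0,1\}$ be pairwise distinct. Let $$C^k_\lambda=\{x_1^k+x_2^k+x_3^k=0,\ \lambda_i x_1^k+x_2^k+x_{i+3}^k=0\ (1\le i\le n-2)\}\subset\mathbb P^n_K,$$ a nonsingular irreducible projective curve, and put $y_j=x_j/x_1$ $(2\le j\le n+1)$, $z=y_2$, and $g_{k,n}=1+\frac{k^{n-1}}{2}\big((k-1)(n-1)-2\big)$. For integers $r\ge 0$ and $0\le\alpha_3,\dots,\alpha_{n+1}\le k-1$ let $$\theta_{r;\alpha_3,\dots,\alpha_{n+1}}=\frac{z^r\,dz}{y_3^{\alpha_3}\cdots y_{n+1}^{\alpha_{n+1}}};$$ the standard basis $\mathcal B^{can}$ is the collection of those $\theta_{r;\alpha_3,\dots,\alpha_{n+1}}$ with $0\le r\le\alpha_3+\cdots+\alpha_{n+1}-2$. Assume $g_{k,n}>1$. Let $e=3$ if $n=2$, $e=2$ if $n=3$, and $e=1$ if $n\ge 4$, and set $$\theta_1=\theta_{0;e,\dots,e},\qquad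 \theta_2=\theta_{1;e,\dots,e},\qquad \theta_j=\theta_{0;e,\dots,e,e-1,e,\dots,e}\quad(3\le j\le n+1),$$ where in $\theta_j$ the exponent of $y_j$ is $e-1$ and all the others are $e$. Then $\theta_1,\dots,\theta_{n+1}$ are members of $\mathcal B^{can}$, they are holomorphic (everywhere regular) forms on $C^k_\lambda$, they are linearly independent over $K$ (in particular distinct), and the map $$C^k_\lambda\to\mathbb P^n_K,\qquad P\mapsto[\theta_1(P):\cdots:\theta_{n+1}(P)]$$ is the identity of $C^k_\lambda\subset\mathbb P^n_K$, i.e. it takes the value $P$, and no other value, at every point $P$ of $C^k_\lambda$. Here the value at $P$ is $[f_1(P):\cdots:f_{n+1}(P)]$ whenever $\theta_i=f_i\,\omega$ for a rational form $\omega$ and rational functions $f_i$ that are regular at $P$ and do not all vanish at $P$. -/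

import Mathlib

open scoped LinearAlgebra.Projectivization KaehlerDifferential

namespace GenFermat

/-! Throughout, `m = n - 2` is the number of parameters `λ_1, …, λ_m`, so that `n = m + 2 ≥ 2`.
The homogeneous coordinates `x_1, …, x_{n+1}` are indexed by `0, …, n` in `Fin (m + 3)`, and the
last `n - 1` coordinates `x_3, …, x_{n+1}` are the `j.succ.succ` with `j : Fin (m + 1)`. -/

/-- The number `g_{k,n} = 1 + (k^{n-1} / 2) ((k - 1) (n - 1) - 2)`. -/
def genus (k n : ℕ) : ℚ :=
  1 + (k : ℚ) ^ (n - 1) / 2 * (((k : ℚ) - 1) * ((n : ℚ) - 1) - 2)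

section

variable {K : Type*} [Field K]

/-- The coefficients `1, λ_1, …, λ_{n-2}` of `x_1 ^ k` in the `n - 1` equations. -/
def coeff {m : ℕ} (lam : Fin m → K) : Fin (m + 1) → K := Fin.cons 1 lam

/-- The curve `C^k_λ ⊂ ℙ^n`, as a set of points: `x_1^k + x_2^k + x_3^k = 0` and
`λ_i x_1^k + x_2^k + x_{i+3}^k = 0` for `i = 1, …, n - 2`. -/
def curve (k : ℕ) {m : ℕ} (lam : Fin m → K) : Set (ℙ K (Fin (m + 3) → K)) :=
  {P | ∀ j : Fin (m + 1),
    coeff lam j * P.rep 0 ^ k + P.rep 1 ^ k + P.rep j.succ.succ ^ k = 0}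

/-- The membership condition can be read off from any vector of homogeneous coordinates. -/
theorem mk_mem_curve_iff (k : ℕ) {m : ℕ} (lam : Fin m → K) (v : Fin (m + 3) → K) (hv : v ≠ 0) :
    Projectivization.mk K v hv ∈ curve k lam ↔
      ∀ j : Fin (m + 1), coeff lam j * v 0 ^ k + v 1 ^ k + v j.succ.succ ^ k = 0 := by
  obtain ⟨a, ha⟩ := Projectivization.exists_smul_eq_mk_rep K v hv
  have h : ∀ i, (Projectivization.mk K v hv).rep i = (a : K) * v i := fun i => by
    rw [← ha]; rfl
  have hak : (a : K) ^ k ≠ 0 := pow_ne_zero _ a.ne_zero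
  refine forall_congr' fun j => ?_
  have e : coeff lam j * (Projectivization.mk K v hv).rep 0 ^ k
      + (Projectivization.mk K v hv).rep 1 ^ k
      + (Projectivization.mk K v hv).rep j.succ.succ ^ k
      = (a : K) ^ k * (coeff lam j * v 0 ^ k + v 1 ^ k + v j.succ.succ ^ k) := by
    rw [h, h, h]; ring
  rw [e, mul_eq_zero, or_iff_right hak]

/-- The coordinate ring of the affine chart `x_1 ≠ 0` of the curve: the quotient of
`K[y_2, …, y_{n+1}]` by `1 + y_2^k + y_3^k` and the `λ_i + y_2^k + y_{i+3}^k`. -/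
abbrev AffineRing (k : ℕ) {m : ℕ} (lam : Fin m → K) : Type _ :=
  MvPolynomial (Fin (m + 2)) K ⧸ Ideal.span (Set.range fun j : Fin (m + 1) =>
    MvPolynomial.C (coeff lam j) + MvPolynomial.X 0 ^ k + MvPolynomial.X j.succ ^ k)

/-- The field `K(C^k_λ)` of rational (meromorphic) functions of the curve: the ring of fractions of
the coordinate ring of the chart `x_1 ≠ 0` (inverting all nonzerodivisors; the curve is irreducible
and nonsingular for the parameters under consideration, so this is the fraction field of a domain). -/
abbrev FunctionField (k : ℕ) {m : ℕ} (lam : Fin m → K) : Type _ :=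
  FractionRing (AffineRing k lam)

/-- The space of rational (meromorphic) differential forms of the curve. -/
abbrev Form (k : ℕ) {m : ℕ} (lam : Fin m → K) : Type _ :=
  Ω[FunctionField k lam⁄K]

/-- The rational functions `x_1/x_1 = 1`, `z = y_2 = x_2/x_1`, `y_3 = x_3/x_1`, …,
`y_{n+1} = x_{n+1}/x_1`. -/
noncomputable def coordFn (k : ℕ) {m : ℕ} (lam : Fin m → K) : Fin (m + 3) → FunctionField k lam :=
  Fin.cons 1 fun i =>
    algebraMap (AffineRing k lam) (FunctionField k lam) (Ideal.Quotient.mk _ (MvPolynomial.X i))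

/-- `HasValueAt k lam P f c`: the rational function `f` is a quotient `F / G` of two homogeneous
polynomials of the same degree with `G(P) ≠ 0` (so `f` is regular at `P`), and `f(P) = c`. A
homogeneous polynomial `F` of degree `d` is turned into the rational function `F / x_1^d` by
substituting `x_j / x_1` for `x_j`. -/
def HasValueAt (k : ℕ) {m : ℕ} (lam : Fin m → K) (P : ℙ K (Fin (m + 3) → K))
    (f : FunctionField k lam) (c : K) : Prop :=
  ∃ (d : ℕ) (F G : MvPolynomial (Fin (m + 3)) K), F.IsHomogeneous d ∧ G.IsHomogeneous d ∧
    MvPolynomial.eval P.rep G ≠ 0 ∧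
    f * MvPolynomial.aeval (coordFn k lam) G = MvPolynomial.aeval (coordFn k lam) F ∧
    c = MvPolynomial.eval P.rep F / MvPolynomial.eval P.rep G

/-- The local ring of the curve at `P`: the rational functions that are regular at `P`. -/
def localRing (k : ℕ) {m : ℕ} (lam : Fin m → K) (P : ℙ K (Fin (m + 3) → K)) :
    Subalgebra K (FunctionField k lam) where
  carrier := {f | ∃ c, HasValueAt k lam P f c}
  mul_mem' := by
    rintro f g ⟨_, d, F, G, hF, hG, h0, h, -⟩ ⟨_, d', F', G', hF', hG', h0', h', -⟩
    refine ⟨_, d + d', F * F', G * G', hF.mul hF', hG.mul hG', ?_, ?_, rfl⟩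
    · rw [map_mul]; exact mul_ne_zero h0 h0'
    · rw [map_mul, map_mul, ← h, ← h']; ring
  add_mem' := by
    rintro f g ⟨_, d, F, G, hF, hG, h0, h, -⟩ ⟨_, d', F', G', hF', hG', h0', h', -⟩
    refine ⟨_, d + d', F * G' + G * F', G * G', (hF.mul hG').add (hG.mul hF'), hG.mul hG',
      ?_, ?_, rfl⟩
    · rw [map_mul]; exact mul_ne_zero h0 h0'
    · rw [map_add, map_mul, map_mul, map_mul, ← h, ← h']; ring
  algebraMap_mem' := by
    intro a
    refine ⟨_, 0, MvPolynomial.C a, 1, MvPolynomial.isHomogeneous_C _ _,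
      MvPolynomial.isHomogeneous_one _ _, ?_, ?_, rfl⟩
    · simp
    · simp

/-- The space `H^{1,0}(C^k_λ)` of holomorphic (everywhere regular) forms: at every point `P` of
the curve, the form is a finite sum `∑ a_i d b_i` with `a_i`, `b_i` regular at `P`. -/
noncomputable def holomorphicForms (k : ℕ) {m : ℕ} (lam : Fin m → K) :
    Submodule K (Form k lam) :=
  ⨅ P ∈ curve k lam, (Submodule.span (localRing k lam P)
    (KaehlerDifferential.D K (FunctionField k lam) '' (localRing k lam P))).restrictScalars K

/-- The form `θ_{r;α_3,…,α_{n+1}} = z^r dz / (y_3^{α_3} ⋯ y_{n+1}^{α_{n+1}})`, where `z = y_2`. -/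
noncomputable def theta (k : ℕ) {m : ℕ} (lam : Fin m → K) (r : ℕ) (α : Fin (m + 1) → ℕ) :
    Form k lam :=
  (coordFn k lam 1 ^ r * Ring.inverse (∏ j : Fin (m + 1), coordFn k lam j.succ.succ ^ α j)) •
    KaehlerDifferential.D K (FunctionField k lam) (coordFn k lam 1)

/-- The index set `I_{k,n}`: all `(r; α_3, …, α_{n+1})` with `0 ≤ α_j ≤ k - 1` and
`0 ≤ r ≤ α_3 + ⋯ + α_{n+1} - 2`. -/
def indexSet (k m : ℕ) : Set (ℕ × (Fin (m + 1) → ℕ)) :=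
  {q | (∀ j, q.2 j < k) ∧ q.1 + 2 ≤ ∑ j, q.2 j}

/-- The standard basis: the collection of the forms `θ_{r;α}` with `(r; α) ∈ I_{k,n}`. -/
def standardBasis (k : ℕ) {m : ℕ} (lam : Fin m → K) : Set (Form k lam) :=
  (fun q : ℕ × (Fin (m + 1) → ℕ) => theta k lam q.1 q.2) '' indexSet k m

/-- The common exponent of `y_3, …, y_{n+1}` in the denominators of `θ_1` and `θ_2`: it is `3` for
`n = 2`, it is `2` for `n = 3`, and it is `1` for `n ≥ 4` (where `n = m + 2`). -/
def baseExponent : ℕ → ℕ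
  | 0 => 3
  | 1 => 2
  | _ + 2 => 1

/-- The indices of the chosen forms, with `e` the base exponent: `(0; e, …, e)` for `θ_1`,
`(1; e, …, e)` for `θ_2`, and, for `θ_j` with `j = 3, …, n + 1`, the index `(0; e, …, e)` with
the entry belonging to `y_j` lowered to `e - 1`. -/
def chosenIndex (m : ℕ) : Fin (m + 3) → ℕ × (Fin (m + 1) → ℕ) :=
  Fin.cons (0, fun _ => baseExponent m) (Fin.cons (1, fun _ => baseExponent m) fun j =>
    (0, Function.update (fun _ => baseExponent m) j (baseExponent m - 1)))

/-- The chosen forms `θ_1, …, θ_{n+1}`. -/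
noncomputable def chosenForm (k : ℕ) {m : ℕ} (lam : Fin m → K) (i : Fin (m + 3)) : Form k lam :=
  theta k lam (chosenIndex m i).1 (chosenIndex m i).2

/-- `IsMapValue k lam θ P Q`: the map `[θ_1 : ⋯ : θ_{n+1}]` takes the value `Q` at `P`. That is,
after the forms are divided by a suitable rational form `ω` (`θ_i = f_i ω`), all quotients `f_i`
are regular at `P`, not all vanish there, and `Q = [f_1(P) : ⋯ : f_{n+1}(P)]`. -/
def IsMapValue (k : ℕ) {m : ℕ} (lam : Fin m → K) (θ : Fin (m + 3) → Form k lam)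
    (P Q : ℙ K (Fin (m + 3) → K)) : Prop :=
  ∃ (ω : Form k lam) (f : Fin (m + 3) → FunctionField k lam) (c : Fin (m + 3) → K) (hc : c ≠ 0),
    (∀ i, θ i = f i • ω) ∧ (∀ i, HasValueAt k lam P (f i) (c i)) ∧ Q = Projectivization.mk K c hc

end

end GenFermat

/-!
All the forms in question are multiples of one of them: writing `x_1, …, x_{n+1}` for the functions
`1, z, y_3, …, y_{n+1}` one has `θ_i = x_i θ_1` (`chosenForm_eq`). As soon as `θ_1` generates the
module of rational forms freely, the map `[θ_1 : ⋯ : θ_{n+1}]` is therefore the identity, and the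
forms are linearly independent because the coordinate functions are.

The facts about the curve that this uses all come from one Nullstellensatz,
`mem_span_of_forall_generic`: a polynomial belongs to the ideal of an affine chart as soon as it
vanishes at the generic points `(t, ξ)` of the chart, where `t` is transcendental over `K` and each
`ξ_j` is a `k`-th root of `-(c_j + t ^ k)`, the `c_j` being the coefficients `1, λ_1, …, λ_{n-2}`. Indeed a polynomial can be reduced modulo the ideal to
one of degree less than `k` in every `y_j`, and for a given `t` the generic points form a product of
sets with `k` elements each. It follows that

* the coordinate functions are invertible in the total ring of fractions of the chart
  (`isUnit_coordFn`) and linearly independent (`linearIndependent_coordFn`);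
* a homogeneous relation between the coordinate functions holds at all points of the projective
  curve (`eval_rep_eq_zero`). For the points with `x_1 = 0` the Nullstellensatz is applied to the
  chart `x_2 ≠ 0`, which has the same generic points.

In particular the values of rational functions are well defined, and the irreducibility of the curve
is not needed. The module of rational forms is free on `dz`: it is generated by `dz` since
`y_j ^ (k-1) dy_j = -z ^ (k-1) dz` (`exists_eq_smul_D`), and `dz` is not annihilated by any nonzero
function because there is a vector field on the chart whose `z`-component is
`∏_j y_j ^ (k-1)`, a unit (`eq_zero_of_smul_D_eq_zero`).

Holomorphy of all the forms of the standard basis (`theta_mem_holomorphicForms`) is checked with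
explicit local parameters: `z` where no coordinate vanishes, `y_j` where `y_j = 0` (there
`dz = -(y_j / z) ^ (k-1) dy_j` and `α_j ≤ k - 1`), and `1 / z` where `x_1 = 0` (there
`dz = -z ^ 2 d(1 / z)` and `r + 2 ≤ ∑_j α_j`).
-/

/-! ### Polynomials vanishing at the roots of `Y_j ^ k = b_j` -/

namespace MvPolynomial

/-- Division by the polynomials `X j ^ k - C (b j)`, which are monic of degree `k` in distinct
variables: the remainder can be taken of degree less than `k` in every variable. -/
theorem exists_sub_mem_span_X_pow_sub_C {R ι : Type*} [CommRing R] {k : ℕ} (hk : 0 < k)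
    (b : ι → R) (p : MvPolynomial ι R) :
    ∃ q : MvPolynomial ι R, (∀ j, q.degreeOf j < k) ∧
      p - q ∈ Ideal.span (Set.range fun j => (X j ^ k - C (b j) : MvPolynomial ι R)) := by
  set I := Ideal.span (Set.range fun j => (X j ^ k - C (b j) : MvPolynomial ι R))
  induction p using MvPolynomial.induction_on' with
  | monomial a r =>
    refine ⟨monomial (a.mapRange (· % k) (Nat.zero_mod k)) (r * a.prod fun j i => b j ^ (i / k)),
      fun j => ?_, ?_⟩
    · rw [degreeOf_lt_iff hk]
      intro s hs
      have := support_monomial_subset hs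
      rw [Finset.mem_singleton] at this
      subst this
      simpa using Nat.mod_lt _ hk
    · rw [← Ideal.Quotient.eq]
      have hX : ∀ j, Ideal.Quotient.mk I (X j) ^ k = Ideal.Quotient.mk I (C (b j)) := fun j => by
        rw [← map_pow, Ideal.Quotient.eq]
        exact Ideal.subset_span ⟨j, rfl⟩
      rw [monomial_eq, monomial_eq, map_mul, map_mul, C_mul, map_mul, mul_assoc]
      congr 1
      rw [Finsupp.prod_mapRange_index (by simp), Finsupp.prod, Finsupp.prod, Finsupp.prod,
        map_prod, map_prod, map_prod, map_prod, ← Finset.prod_mul_distrib]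
      refine Finset.prod_congr rfl fun j _ => ?_
      rw [C_pow, map_pow, map_pow, map_pow, ← hX, ← pow_mul, ← pow_add, Nat.div_add_mod]
  | add p₁ p₂ h₁ h₂ =>
    obtain ⟨q₁, hd₁, hm₁⟩ := h₁
    obtain ⟨q₂, hd₂, hm₂⟩ := h₂
    refine ⟨q₁ + q₂, fun j => (degreeOf_add_le _ _ _).trans_lt (max_lt (hd₁ j) (hd₂ j)), ?_⟩
    rw [add_sub_add_comm]
    exact I.add_mem hm₁ hm₂

/-- The Nullstellensatz for the ideal of the polynomials `X j ^ k - C (b j)`, with all `b j`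
nonzero: the remainder of the division vanishes on a product of sets with `k` elements each, and
its degree in each variable is too small for that unless it is zero. -/
theorem mem_span_X_pow_sub_C_of_forall_aeval_eq_zero {R L ι : Type*} [CommRing R] [Field L]
    [IsAlgClosed L] [Algebra R L] [Finite ι] (hRL : Function.Injective (algebraMap R L)) {k : ℕ}
    (hk : (k : L) ≠ 0) {b : ι → R} (hb : ∀ j, b j ≠ 0) {p : MvPolynomial ι R}
    (hp : ∀ ξ : ι → L, (∀ j, ξ j ^ k = algebraMap R L (b j)) → aeval ξ p = 0) :
    p ∈ Ideal.span (Set.range fun j => (X j ^ k - C (b j) : MvPolynomial ι R)) := by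
  classical
  have hk0 : 0 < k := Nat.pos_of_ne_zero fun h => hk (by simp [h])
  obtain ⟨q, hqd, hq⟩ := exists_sub_mem_span_X_pow_sub_C hk0 b p
  suffices hq0 : q = 0 by rwa [hq0, sub_zero] at hq
  have hb' : ∀ j, algebraMap R L (b j) ≠ 0 := fun j =>
    (map_ne_zero_iff _ hRL).2 (hb j)
  refine map_injective _ hRL ?_
  rw [map_zero]
  refine eq_zero_of_eval_zero_at_prod_finset _
    (fun j => (Polynomial.nthRoots k (algebraMap R L (b j))).toFinset) (fun j => ?_)
    fun ξ hξ => ?_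
  · rw [Multiset.toFinset_card_of_nodup, Polynomial.nthRoots,
      IsAlgClosed.card_roots_eq_natDegree, Polynomial.natDegree_X_pow_sub_C]
    · rw [degreeOf_lt_iff hk0]
      exact fun s hs => (degreeOf_lt_iff hk0).1 (hqd j) s (support_map_subset _ _ hs)
    · exact Polynomial.nodup_roots (Polynomial.separable_X_pow_sub_C _ hk (hb' j))
  · replace hξ : ∀ j, ξ j ^ k = algebraMap R L (b j) := fun j => by
      simpa [Polynomial.mem_nthRoots hk0] using hξ j
    rw [eval_map, ← aeval_def]
    have h0 : aeval ξ (p - q) = 0 := by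
      suffices h : Ideal.span _ ≤ RingHom.ker (aeval (R := R) ξ) from h hq
      rw [Ideal.span_le]
      rintro _ ⟨j, rfl⟩
      simp [RingHom.mem_ker, hξ]
    rw [map_sub, hp ξ hξ, zero_sub, neg_eq_zero] at h0
    exact h0

end MvPolynomial

namespace GenFermat

/-! ### Generic points of affine charts -/

variable {K : Type*} [Field K]

/-- An algebraically closed field containing the rational function field in one variable, used
as the field of coordinates of generic points. -/
abbrev GenericField (K : Type*) [Field K] : Type _ := AlgebraicClosure (RatFunc K)

/-- The transcendental element of `GenericField K`. -/
noncomputable def genericParam (K : Type*) [Field K] : GenericField K :=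
  algebraMap (RatFunc K) (GenericField K) RatFunc.X

theorem algebraMap_polynomial_genericField_injective :
    Function.Injective (algebraMap (Polynomial K) (GenericField K)) := by
  rw [IsScalarTower.algebraMap_eq (Polynomial K) (RatFunc K) (GenericField K)]
  exact (algebraMap (RatFunc K) (GenericField K)).injective.comp (RatFunc.algebraMap_injective K)

theorem aeval_genericParam (f : Polynomial K) :
    Polynomial.aeval (genericParam K) f = algebraMap (Polynomial K) (GenericField K) f := by
  have h : algebraMap (Polynomial K) (GenericField K) Polynomial.X = genericParam K := by
    rw [IsScalarTower.algebraMap_apply (Polynomial K) (RatFunc K) (GenericField K),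
      RatFunc.algebraMap_X]
    rfl
  rw [← h, Polynomial.aeval_algebraMap_apply, Polynomial.aeval_X_left_apply]

theorem aeval_genericParam_ne_zero {f : Polynomial K} (hf : f ≠ 0) :
    Polynomial.aeval (genericParam K) f ≠ 0 := by
  rw [aeval_genericParam]
  exact (map_ne_zero_iff _ algebraMap_polynomial_genericField_injective).2 hf

theorem genericParam_ne_zero : genericParam K ≠ 0 := by
  simpa using aeval_genericParam_ne_zero (K := K) Polynomial.X_ne_zero

theorem C_add_C_mul_X_pow_ne_zero {k : ℕ} (hk : k ≠ 0) {u v : K} (h : u ≠ 0 ∨ v ≠ 0) :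
    Polynomial.C u + Polynomial.C v * Polynomial.X ^ k ≠ 0 := by
  intro h0
  have h1 := congrArg (Polynomial.coeff · 0) h0
  have h2 := congrArg (Polynomial.coeff · k) h0
  simp [Polynomial.coeff_X_pow, hk.symm, Polynomial.coeff_C, hk] at h1 h2
  tauto

theorem add_mul_genericParam_pow_ne_zero {k : ℕ} (hk : k ≠ 0) {u v : K} (h : u ≠ 0 ∨ v ≠ 0) :
    algebraMap K (GenericField K) u + algebraMap K (GenericField K) v * genericParam K ^ k ≠ 0 := by
  simpa using aeval_genericParam_ne_zero (C_add_C_mul_X_pow_ne_zero hk h)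

/-- A polynomial that vanishes at all the points of the affine variety
`u_j + v_j X_0 ^ k + X_{j+1} ^ k = 0` lying above the generic point of the `X_0`-line belongs to
the ideal of these equations. -/
theorem mem_span_of_forall_generic {n k : ℕ} (hk : (k : K) ≠ 0) {u v : Fin n → K}
    (huv : ∀ j, u j ≠ 0 ∨ v j ≠ 0) {f : MvPolynomial (Fin (n + 1)) K}
    (hf : ∀ ξ : Fin n → GenericField K,
      (∀ j, algebraMap K (GenericField K) (u j)
        + algebraMap K (GenericField K) (v j) * genericParam K ^ k + ξ j ^ k = 0) →
      MvPolynomial.aeval (Fin.cons (genericParam K) ξ : Fin (n + 1) → GenericField K) f = 0) :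
    f ∈ Ideal.span (Set.range fun j : Fin n =>
      (MvPolynomial.C (u j) + MvPolynomial.C (v j) * MvPolynomial.X 0 ^ k
        + MvPolynomial.X j.succ ^ k : MvPolynomial (Fin (n + 1)) K)) := by
  have hk0 : k ≠ 0 := fun h => hk (by simp [h])
  -- regard `f` as a polynomial in the other variables with coefficients in `K[X_0]`
  let φ : MvPolynomial (Fin (n + 1)) K →ₐ[K] MvPolynomial (Fin n) (Polynomial K) :=
    MvPolynomial.aeval (Fin.cons (MvPolynomial.C Polynomial.X) MvPolynomial.X)
  let ψ : MvPolynomial (Fin n) (Polynomial K) →+* MvPolynomial (Fin (n + 1)) K :=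
    MvPolynomial.eval₂Hom (Polynomial.aeval (MvPolynomial.X 0)).toRingHom
      fun j => MvPolynomial.X j.succ
  have hψφ : ψ (φ f) = f := by
    suffices h : ψ.comp φ.toRingHom = RingHom.id _ from congrArg (· f) h
    refine MvPolynomial.ringHom_ext (fun a => ?_) fun i => ?_
    · simp [φ, ψ, IsScalarTower.algebraMap_apply K (Polynomial K)
        (MvPolynomial (Fin n) (Polynomial K)), MvPolynomial.algebraMap_eq]
    · refine Fin.cases ?_ (fun j => ?_) i <;> simp [φ, ψ]
  have hφ : φ f ∈ Ideal.span (Set.range fun j => (MvPolynomial.X j ^ k - MvPolynomial.C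
      (-(Polynomial.C (u j) + Polynomial.C (v j) * Polynomial.X ^ k)) :
        MvPolynomial (Fin n) (Polynomial K))) := by
    refine MvPolynomial.mem_span_X_pow_sub_C_of_forall_aeval_eq_zero (L := GenericField K)
      algebraMap_polynomial_genericField_injective ?_
      (fun j => neg_ne_zero.2 (C_add_C_mul_X_pow_ne_zero hk0 (huv j))) fun ξ hξ => ?_
    · rw [← map_natCast (algebraMap K (GenericField K))]
      exact (map_ne_zero _).2 hk
    · rw [← hf ξ fun j => ?_]
      · suffices h : ((MvPolynomial.aeval (R := Polynomial K) ξ).restrictScalars K).comp φ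
            = MvPolynomial.aeval (Fin.cons (genericParam K) ξ : Fin (n + 1) → GenericField K) from
          DFunLike.congr_fun h f
        refine MvPolynomial.algHom_ext fun i => ?_
        refine Fin.cases ?_ (fun j => ?_) i
        · simp [φ, ← aeval_genericParam]
        · simp [φ]
      · rw [hξ, ← aeval_genericParam]
        simp
  rw [← hψφ]
  refine Ideal.mem_comap.1 ((Ideal.span_le.2 ?_ : _ ≤ Ideal.comap ψ _) hφ)
  rintro _ ⟨j, rfl⟩
  refine Ideal.subset_span ⟨j, ?_⟩
  simp [ψ]
  ring

/-! ### The affine chart `x_1 ≠ 0` and its points -/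

/-- Evaluation of the regular functions on the chart `x_1 ≠ 0` at a point `y` of this chart with
coordinates in a `K`-algebra. -/
noncomputable def evalPoint {k m : ℕ} {lam : Fin m → K} {L : Type*} [CommRing L] [Algebra K L]
    (y : Fin (m + 2) → L)
    (hy : ∀ j : Fin (m + 1), algebraMap K L (coeff lam j) + y 0 ^ k + y j.succ ^ k = 0) :
    AffineRing k lam →ₐ[K] L :=
  Ideal.Quotient.liftₐ _ (MvPolynomial.aeval y) fun a ha => by
    suffices h : _ ≤ RingHom.ker (MvPolynomial.aeval (R := K) y) from h ha
    rw [Ideal.span_le]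
    rintro _ ⟨j, rfl⟩
    simp [RingHom.mem_ker, hy]

theorem evalPoint_mk {k m : ℕ} {lam : Fin m → K} {L : Type*} [CommRing L] [Algebra K L]
    (y : Fin (m + 2) → L)
    (hy : ∀ j : Fin (m + 1), algebraMap K L (coeff lam j) + y 0 ^ k + y j.succ ^ k = 0)
    (f : MvPolynomial (Fin (m + 2)) K) :
    evalPoint y hy (Ideal.Quotient.mk _ f) = MvPolynomial.aeval y f := rfl

/-- The condition for `(t, ξ)`, where `t` is the transcendental parameter, to be a point of the
chart `x_1 ≠ 0`. -/
def IsGenericPoint (k : ℕ) {m : ℕ} (lam : Fin m → K) (ξ : Fin (m + 1) → GenericField K) : Prop :=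
  ∀ j : Fin (m + 1), algebraMap K (GenericField K) (coeff lam j)
    + (Fin.cons (genericParam K) ξ : Fin (m + 2) → GenericField K) 0 ^ k
    + (Fin.cons (genericParam K) ξ : Fin (m + 2) → GenericField K) j.succ ^ k = 0

section

variable {k m : ℕ} {lam : Fin m → K}

/-- The coordinate `y_{j+3}` does not vanish at the generic points, since `c_j + t ^ k ≠ 0`. -/
theorem IsGenericPoint.ne_zero (hk : k ≠ 0) {ξ : Fin (m + 1) → GenericField K}
    (hξ : IsGenericPoint k lam ξ) (j : Fin (m + 1)) : ξ j ≠ 0 := by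
  intro h0
  have h := hξ j
  rw [Fin.cons_succ, Fin.cons_zero, h0, zero_pow hk, add_zero] at h
  exact add_mul_genericParam_pow_ne_zero hk (u := coeff lam j) (Or.inr one_ne_zero)
    (by simpa using h)

theorem exists_isGenericPoint (hk : k ≠ 0) :
    ∃ ξ : Fin (m + 1) → GenericField K, IsGenericPoint k lam ξ := by
  choose ξ hξ using fun j : Fin (m + 1) => IsAlgClosed.exists_pow_nat_eq
    (-(algebraMap K (GenericField K) (coeff lam j) + genericParam K ^ k)) (Nat.pos_of_ne_zero hk)
  refine ⟨ξ, fun j => ?_⟩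
  rw [Fin.cons_succ, Fin.cons_zero, hξ]
  ring

/-- A regular function on the chart `x_1 ≠ 0` is determined by its values at the generic points;
in particular the coordinate ring is reduced. -/
theorem eq_zero_of_forall_evalPoint (hk : (k : K) ≠ 0) {s : AffineRing k lam}
    (hs : ∀ ξ, ∀ hξ : IsGenericPoint k lam ξ, evalPoint _ hξ s = 0) : s = 0 := by
  obtain ⟨f, rfl⟩ := Ideal.Quotient.mk_surjective s
  rw [Ideal.Quotient.eq_zero_iff_mem]
  have h := mem_span_of_forall_generic hk (u := coeff lam) (v := fun _ => 1) (f := f)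
    (fun _ => Or.inr one_ne_zero) fun ξ hξ => hs ξ fun j => by simpa using hξ j
  simpa using h

theorem mem_nonZeroDivisors_of_forall_evalPoint (hk : (k : K) ≠ 0) {s : AffineRing k lam}
    (hs : ∀ ξ, ∀ hξ : IsGenericPoint k lam ξ, evalPoint _ hξ s ≠ 0) :
    s ∈ nonZeroDivisors (AffineRing k lam) := by
  rw [mem_nonZeroDivisors_iff_right]
  intro x hx
  refine eq_zero_of_forall_evalPoint hk fun ξ hξ => ?_
  have h := congrArg (evalPoint _ hξ) hx
  rw [map_mul, map_zero] at h
  exact (mul_eq_zero.1 h).resolve_right (hs ξ hξ)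

theorem coordFn_zero : coordFn k lam 0 = 1 := rfl

theorem coordFn_succ (i : Fin (m + 2)) : coordFn k lam i.succ =
    algebraMap (AffineRing k lam) (FunctionField k lam)
      (Ideal.Quotient.mk _ (MvPolynomial.X i)) := rfl

theorem coordFn_relation (j : Fin (m + 1)) :
    algebraMap K (FunctionField k lam) (coeff lam j) + coordFn k lam 1 ^ k
      + coordFn k lam j.succ.succ ^ k = 0 := by
  have h : Ideal.Quotient.mk (Ideal.span (Set.range fun j : Fin (m + 1) =>
      MvPolynomial.C (coeff lam j) + MvPolynomial.X 0 ^ k + MvPolynomial.X j.succ ^ k))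
      (MvPolynomial.C (coeff lam j) + MvPolynomial.X 0 ^ k + MvPolynomial.X j.succ ^ k) = 0 :=
    Ideal.Quotient.eq_zero_iff_mem.2 (Ideal.subset_span ⟨j, rfl⟩)
  have h' := congrArg (algebraMap (AffineRing k lam) (FunctionField k lam)) h
  rw [map_zero, map_add, map_add, map_add, map_add, map_pow, map_pow, map_pow, map_pow] at h'
  exact h'

/-- All coordinate functions are invertible: they do not vanish at the generic points. -/
theorem isUnit_coordFn (hk : (k : K) ≠ 0) (i : Fin (m + 3)) : IsUnit (coordFn k lam i) := by
  have hk0 : k ≠ 0 := fun h => hk (by simp [h])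
  refine Fin.cases isUnit_one (fun i => ?_) i
  rw [coordFn_succ]
  refine IsLocalization.map_units (FunctionField k lam)
    (⟨_, mem_nonZeroDivisors_of_forall_evalPoint hk fun ξ hξ => ?_⟩ :
      nonZeroDivisors (AffineRing k lam))
  change MvPolynomial.aeval _ (MvPolynomial.X i) ≠ 0
  rw [MvPolynomial.aeval_X]
  exact Fin.cases genericParam_ne_zero (fun j => hξ.ne_zero hk0 j) i

/-- Substituting the coordinate functions into a polynomial in the homogeneous coordinates amounts
to dehomogenizing it with respect to `x_1`. -/
theorem aeval_coordFn (H : MvPolynomial (Fin (m + 3)) K) :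
    MvPolynomial.aeval (coordFn k lam) H = algebraMap (AffineRing k lam) (FunctionField k lam)
      (Ideal.Quotient.mk _ (MvPolynomial.aeval
        (Fin.cons 1 MvPolynomial.X : Fin (m + 3) → MvPolynomial (Fin (m + 2)) K) H)) := by
  let φ : MvPolynomial (Fin (m + 2)) K →ₐ[K] FunctionField k lam :=
    (IsScalarTower.toAlgHom K (AffineRing k lam) (FunctionField k lam)).comp
      (Ideal.Quotient.mkₐ K _)
  suffices h : MvPolynomial.aeval (coordFn k lam) = φ.comp (MvPolynomial.aeval
      (Fin.cons 1 MvPolynomial.X : Fin (m + 3) → MvPolynomial (Fin (m + 2)) K)) from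
    DFunLike.congr_fun h H
  refine MvPolynomial.algHom_ext fun i => ?_
  rw [MvPolynomial.aeval_X, AlgHom.comp_apply, MvPolynomial.aeval_X]
  refine Fin.cases ?_ (fun i => ?_) i
  · simp [coordFn_zero]
  · rfl

/-- A polynomial relation between the coordinate functions holds at every point of the chart
`x_1 ≠ 0`. -/
theorem aeval_cons_one_eq_zero {L : Type*} [CommRing L] [Algebra K L]
    {y : Fin (m + 2) → L}
    (hy : ∀ j : Fin (m + 1), algebraMap K L (coeff lam j) + y 0 ^ k + y j.succ ^ k = 0)
    {H : MvPolynomial (Fin (m + 3)) K} (hH : MvPolynomial.aeval (coordFn k lam) H = 0) :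
    MvPolynomial.aeval (Fin.cons 1 y : Fin (m + 3) → L) H = 0 := by
  rw [aeval_coordFn] at hH
  have h0 := (IsFractionRing.injective (AffineRing k lam) (FunctionField k lam))
    (hH.trans (map_zero _).symm)
  have h := congrArg (evalPoint y hy) h0
  rw [evalPoint_mk, map_zero] at h
  rw [← h]
  suffices h : MvPolynomial.aeval (Fin.cons 1 y : Fin (m + 3) → L)
      = (MvPolynomial.aeval (R := K) y).comp (MvPolynomial.aeval
      (Fin.cons 1 MvPolynomial.X : Fin (m + 3) → MvPolynomial (Fin (m + 2)) K)) from
    DFunLike.congr_fun h H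
  refine MvPolynomial.algHom_ext fun i => ?_
  rw [MvPolynomial.aeval_X, AlgHom.comp_apply, MvPolynomial.aeval_X]
  refine Fin.cases ?_ (fun i => ?_) i <;> simp

/-- The functions `1, z, y_3, …, y_{n+1}` are linearly independent: the coefficient of `y_{j+3}`
is detected by two generic points that differ only in that coordinate. -/
theorem linearIndependent_coordFn (hk2 : 2 ≤ k) (hk : (k : K) ≠ 0) :
    LinearIndependent K (coordFn k lam) := by
  have hk0 : k ≠ 0 := by omega
  rw [Fintype.linearIndependent_iff]
  intro a ha
  have key : ∀ ξ : Fin (m + 1) → GenericField K, IsGenericPoint k lam ξ →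
      algebraMap K (GenericField K) (a 0) + (algebraMap K (GenericField K) (a 1) * genericParam K
        + ∑ j : Fin (m + 1), algebraMap K (GenericField K) (a j.succ.succ) * ξ j) = 0 := by
    intro ξ hξ
    have h := aeval_cons_one_eq_zero (lam := lam) (k := k) hξ
      (H := ∑ i, MvPolynomial.C (a i) * MvPolynomial.X i)
      (by rw [← ha]; simp [Algebra.smul_def])
    rw [map_sum, Fin.sum_univ_succ, Fin.sum_univ_succ] at h
    simpa using h
  obtain ⟨ξ, hξ⟩ := exists_isGenericPoint (lam := lam) hk0
  have hsucc : ∀ j : Fin (m + 1), a j.succ.succ = 0 := by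
    intro j
    -- multiplying `ξ j` by a nontrivial `k`-th root of unity gives another generic point
    obtain ⟨ζ, hζ1, hζ⟩ : ∃ ζ : GenericField K, ζ ≠ 1 ∧ ζ ^ k = 1 := by
      have : NeZero (k : GenericField K) := ⟨by
        rw [← map_natCast (algebraMap K (GenericField K))]
        exact (map_ne_zero _).2 hk⟩
      obtain ⟨ζ, hζ⟩ := HasEnoughRootsOfUnity.exists_primitiveRoot (GenericField K) k
      exact ⟨ζ, hζ.ne_one (by omega), hζ.pow_eq_one⟩
    have hξ' : IsGenericPoint k lam (Function.update ξ j (ζ * ξ j)) := by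
      intro i
      have h := hξ i
      rw [Fin.cons_zero, Fin.cons_succ] at h ⊢
      rcases eq_or_ne i j with rfl | hij
      · rwa [Function.update_self, mul_pow, hζ, one_mul]
      · rwa [Function.update_of_ne hij]
    have h1 := key _ hξ
    have h2 := key _ hξ'
    rw [← Finset.add_sum_erase _ _ (Finset.mem_univ j)] at h1 h2
    rw [Function.update_self, Finset.sum_congr rfl (fun i hi => by
      rw [Function.update_of_ne (Finset.ne_of_mem_erase hi)])] at h2
    have h3 : algebraMap K (GenericField K) (a j.succ.succ) * ((ζ - 1) * ξ j) = 0 := by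
      linear_combination h2 - h1
    have h4 := (mul_eq_zero.1 h3).resolve_right
      (mul_ne_zero (sub_ne_zero.2 hζ1) (hξ.ne_zero hk0 j))
    exact (map_eq_zero _).1 h4
  have h := key ξ hξ
  simp only [hsucc, map_zero, zero_mul, Finset.sum_const_zero, add_zero] at h
  have h01 : a 0 = 0 ∧ a 1 = 0 := by
    by_contra hne
    rw [not_and_or] at hne
    exact add_mul_genericParam_pow_ne_zero one_ne_zero hne (by rwa [pow_one])
  intro i
  exact Fin.cases h01.1 (fun i => Fin.cases h01.2 hsucc i) i

theorem _root_.MvPolynomial.IsHomogeneous.aeval_smul_eq {σ R L : Type*} [CommRing R] [CommRing L]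
    [Algebra R L] {H : MvPolynomial σ R} {d : ℕ} (hd : H.IsHomogeneous d) (r : L) (x : σ → L) :
    MvPolynomial.aeval (r • x) H = r ^ d * MvPolynomial.aeval x H := by
  rw [MvPolynomial.aeval_def, MvPolynomial.aeval_def, MvPolynomial.eval₂_eq, MvPolynomial.eval₂_eq,
    Finset.mul_sum]
  refine Finset.sum_congr rfl fun s hs => ?_
  have hs' : ∑ i ∈ s.support, s i = d := by
    rw [← hd (MvPolynomial.mem_support_iff.1 hs), Finsupp.weight_apply, Finsupp.sum]
    simp
  simp only [Pi.smul_apply, smul_eq_mul, mul_pow, Finset.prod_mul_distrib,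
    Finset.prod_pow_eq_pow_sum, hs']
  ring

theorem rep_zero_ne_zero_or_rep_one_ne_zero (hk : k ≠ 0) {P : ℙ K (Fin (m + 3) → K)}
    (hP : P ∈ curve k lam) : P.rep 0 ≠ 0 ∨ P.rep 1 ≠ 0 := by
  by_contra! h
  refine P.rep_nonzero (funext fun i => ?_)
  refine Fin.cases h.1 (fun i => Fin.cases h.2 (fun j => ?_) i) i
  have h' := hP j
  rw [h.1, h.2, zero_pow hk, mul_zero, add_zero, zero_add] at h'
  exact eq_zero_of_pow_eq_zero h'

/-- A homogeneous relation between the coordinate functions holds at every point of the projective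
curve. At a point with `x_1 = 0` this rests on the same description of the ideal of the curve in
the chart `x_2 ≠ 0`: the generic points of the two charts are the same. -/
theorem eval_rep_eq_zero (hk : (k : K) ≠ 0) {d : ℕ}
    {H : MvPolynomial (Fin (m + 3)) K} (hd : H.IsHomogeneous d)
    (hH : MvPolynomial.aeval (coordFn k lam) H = 0) {P : ℙ K (Fin (m + 3) → K)}
    (hP : P ∈ curve k lam) : MvPolynomial.eval P.rep H = 0 := by
  have hk0 : k ≠ 0 := fun h => hk (by simp [h])
  rw [← MvPolynomial.coe_aeval_eq_eval, RingHom.coe_coe]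
  by_cases h0 : P.rep 0 = 0
  · have h1 := (rep_zero_ne_zero_or_rep_one_ne_zero hk0 hP).resolve_left (not_not.2 h0)
    let g : Fin (m + 3) → MvPolynomial (Fin (m + 2)) K :=
      Fin.cons (MvPolynomial.X 0) (Fin.cons 1 fun j : Fin (m + 1) => MvPolynomial.X j.succ)
    have hcomp : ∀ {L : Type _} [CommRing L] [Algebra K L] (w : L) (ξ : Fin (m + 1) → L),
        MvPolynomial.aeval (Fin.cons w ξ : Fin (m + 2) → L) (MvPolynomial.aeval g H)
          = MvPolynomial.aeval (Fin.cons w (Fin.cons 1 ξ) : Fin (m + 3) → L) H := by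
      intro L _ _ w ξ
      rw [← AlgHom.comp_apply]
      congr 1
      refine MvPolynomial.algHom_ext fun i => ?_
      refine Fin.cases ?_ (fun i => Fin.cases ?_ (fun j => ?_) i) i <;> simp [g]
    have ht := genericParam_ne_zero (K := K)
    have hmem := mem_span_of_forall_generic hk (u := fun _ => 1) (v := coeff lam)
      (f := MvPolynomial.aeval g H) (fun _ => Or.inl one_ne_zero) fun ξ hξ => by
        -- the point `(t : 1 : ξ)` is the point `(1 : t⁻¹ : t⁻¹ ξ)` of the chart `x_1 ≠ 0`
        rw [hcomp]
        have h := aeval_cons_one_eq_zero (k := k) (lam := lam)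
          (y := Fin.cons (genericParam K)⁻¹ fun j => (genericParam K)⁻¹ * ξ j) (fun j => by
            have h' := hξ j
            rw [map_one] at h'
            rw [Fin.cons_zero, Fin.cons_succ, mul_pow, inv_pow]
            have : genericParam K ^ k ≠ 0 := pow_ne_zero _ ht
            field_simp
            linear_combination h') hH
        have h2 := hd.aeval_smul_eq (genericParam K)
          (Fin.cons 1 (Fin.cons (genericParam K)⁻¹ fun j => (genericParam K)⁻¹ * ξ j) :
            Fin (m + 3) → GenericField K)
        rw [h, mul_zero] at h2
        rw [← h2]
        congr 2
        funext i
        refine Fin.cases ?_ (fun i => Fin.cases ?_ (fun j => ?_) i) i <;> simp [ht]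
    have hx : MvPolynomial.aeval (Fin.cons 0 fun j => (P.rep 1)⁻¹ * P.rep j.succ.succ :
        Fin (m + 2) → K) (MvPolynomial.aeval g H) = 0 := by
      suffices h : Ideal.span _ ≤ RingHom.ker (MvPolynomial.aeval (R := K)
        (Fin.cons 0 fun j => (P.rep 1)⁻¹ * P.rep j.succ.succ : Fin (m + 2) → K)) from h hmem
      rw [Ideal.span_le]
      rintro _ ⟨j, rfl⟩
      have h' := hP j
      rw [h0, zero_pow hk0, mul_zero, zero_add] at h'
      have : P.rep 1 ^ k ≠ 0 := pow_ne_zero _ h1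
      simp [RingHom.mem_ker, hk0, mul_pow]
      field_simp
      rw [h', mul_zero]
    rw [hcomp] at hx
    have h2 := hd.aeval_smul_eq (P.rep 1)
      (Fin.cons 0 (Fin.cons 1 fun j => (P.rep 1)⁻¹ * P.rep j.succ.succ) : Fin (m + 3) → K)
    rw [hx, mul_zero] at h2
    rw [← h2]
    congr 2
    funext i
    refine Fin.cases ?_ (fun i => Fin.cases ?_ (fun j => ?_) i) i <;> simp [h0, h1]
  · have h := aeval_cons_one_eq_zero (k := k) (lam := lam)
      (y := fun i => (P.rep 0)⁻¹ * P.rep i.succ) (fun j => by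
        have h' := hP j
        have : P.rep 0 ^ k ≠ 0 := pow_ne_zero _ h0
        rw [mul_pow, mul_pow, inv_pow]
        field_simp
        simp
        linear_combination h') hH
    have h2 := hd.aeval_smul_eq (P.rep 0)
      (Fin.cons 1 fun i => (P.rep 0)⁻¹ * P.rep i.succ : Fin (m + 3) → K)
    rw [h, mul_zero] at h2
    rw [← h2]
    congr 2
    funext i
    refine Fin.cases ?_ (fun i => ?_) i <;> simp [h0]

end

end GenFermat

/-! ### Differentials of the function field -/

/-- A derivation of `S` extends to a localization `T` of `S`, and hence induces a `T`-linear
functional on `Ω[T⁄R]`. -/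
theorem KaehlerDifferential.exists_functional_of_isLocalization {R S : Type*} (T : Type*)
    [CommRing R] [CommRing S] [CommRing T] [Algebra R S] [Algebra R T] [Algebra S T]
    [IsScalarTower R S T] (M : Submonoid S) [IsLocalization M T] (δ : Derivation R S S) :
    ∃ Φ : Ω[T⁄R] →ₗ[T] T, ∀ s, Φ (D R T (algebraMap S T s)) = algebraMap S T (δ s) := by
  have := Algebra.FormallyEtale.of_isLocalization (Rₘ := T) M
  refine ⟨(TensorProduct.AlgebraTensorModule.rid S T T).toLinearMap ∘ₗ
    δ.liftKaehlerDifferential.baseChange T ∘ₗ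
      (tensorKaehlerEquivOfFormallyEtale R S T).symm.toLinearMap, fun s => ?_⟩
  simp only [LinearMap.comp_apply, LinearEquiv.coe_coe,
    tensorKaehlerEquivOfFormallyEtale_symm_D_algebraMap, LinearMap.baseChange_tmul,
    Derivation.liftKaehlerDifferential_comp_D, TensorProduct.AlgebraTensorModule.rid_tmul]
  rw [Algebra.smul_def, mul_one]

namespace GenFermat

variable {K : Type*} [Field K]

section

variable {k m : ℕ} {lam : Fin m → K}

local notation "dd" => KaehlerDifferential.D K (FunctionField k lam)

/-- The differential of the equation `c_j + z ^ k + y_{j+3} ^ k = 0`. -/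
theorem coordFn_pow_smul_D (hk : (k : K) ≠ 0) (j : Fin (m + 1)) :
    coordFn k lam j.succ.succ ^ (k - 1) • dd (coordFn k lam j.succ.succ)
      = -(coordFn k lam 1 ^ (k - 1) • dd (coordFn k lam 1)) := by
  have h := congrArg dd (coordFn_relation (k := k) (lam := lam) j)
  rw [map_add, map_add, Derivation.map_algebraMap, Derivation.leibniz_pow, Derivation.leibniz_pow,
    map_zero, zero_add, ← smul_add, ← Nat.cast_smul_eq_nsmul K] at h
  exact eq_neg_of_add_eq_zero_right ((smul_eq_zero.1 h).resolve_left hk)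

/-- The polynomial vector field `w ∂/∂z - ∑_j z ^ (k-1) (w / y_j ^ (k-1)) ∂/∂y_j`, where
`w = ∏_j y_j ^ (k-1)`, is tangent to the curve. -/
theorem exists_derivation : ∃ δ : Derivation K (AffineRing k lam) (AffineRing k lam),
    δ (Ideal.Quotient.mk _ (MvPolynomial.X 0))
      = Ideal.Quotient.mk _ (∏ j : Fin (m + 1), MvPolynomial.X j.succ ^ (k - 1)) := by
  let w : MvPolynomial (Fin (m + 2)) K := ∏ j : Fin (m + 1), MvPolynomial.X j.succ ^ (k - 1)
  let v : Fin (m + 2) → MvPolynomial (Fin (m + 2)) K := Fin.cons w fun j =>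
    -(MvPolynomial.X 0 ^ (k - 1) *
      ∏ i ∈ Finset.univ.erase j, MvPolynomial.X (Fin.succ i) ^ (k - 1))
  let d := MvPolynomial.mkDerivation K v
  let I := Ideal.span (Set.range fun j : Fin (m + 1) =>
    MvPolynomial.C (coeff lam j) + MvPolynomial.X 0 ^ k + MvPolynomial.X j.succ ^ k)
  have hd : ∀ x ∈ I, d x ∈ I := by
    intro x hx
    induction hx using Submodule.span_induction with
    | mem x hx =>
      obtain ⟨j, rfl⟩ := hx
      have hw : w = MvPolynomial.X j.succ ^ (k - 1) *
          ∏ i ∈ Finset.univ.erase j, MvPolynomial.X (Fin.succ i) ^ (k - 1) :=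
        (Finset.mul_prod_erase _ _ (Finset.mem_univ j)).symm
      convert I.zero_mem using 1
      rw [map_add, map_add, Derivation.leibniz_pow, Derivation.leibniz_pow,
        MvPolynomial.derivation_C, MvPolynomial.mkDerivation_X, MvPolynomial.mkDerivation_X]
      simp only [v, Fin.cons_zero, Fin.cons_succ, hw, smul_eq_mul, nsmul_eq_mul]
      ring
    | zero => rw [map_zero]; exact I.zero_mem
    | add x y _ _ hx hy => rw [map_add]; exact I.add_mem hx hy
    | smul a x hx' hx =>
      rw [smul_eq_mul, Derivation.leibniz]
      exact I.add_mem (I.mul_mem_left _ hx) (I.mul_mem_right _ hx')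
  refine ⟨Derivation.liftOfSurjective (f := Ideal.Quotient.mkₐ K I)
    (Ideal.Quotient.mkₐ_surjective K I) (d := d) fun x hx => ?_, ?_⟩
  · exact Ideal.Quotient.eq_zero_iff_mem.2 (hd x (Ideal.Quotient.eq_zero_iff_mem.1 hx))
  · refine (Derivation.liftOfSurjective_apply (f := Ideal.Quotient.mkₐ K I)
      (Ideal.Quotient.mkₐ_surjective K I) _ _).trans ?_
    rw [MvPolynomial.mkDerivation_X]
    rfl

/-- `dz` is not annihilated by any nonzero rational function: the functional given by a vector field
on the chart takes an invertible value on it. -/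
theorem eq_zero_of_smul_D_eq_zero (hk : (k : K) ≠ 0) {g : FunctionField k lam}
    (hg : g • dd (coordFn k lam 1) = 0) : g = 0 := by
  obtain ⟨δ, hδ⟩ := exists_derivation (k := k) (lam := lam)
  obtain ⟨Φ, hΦ⟩ := KaehlerDifferential.exists_functional_of_isLocalization (FunctionField k lam)
    (nonZeroDivisors (AffineRing k lam)) δ
  have h := congrArg Φ hg
  have h1 : coordFn k lam 1 = algebraMap (AffineRing k lam) (FunctionField k lam)
    (Ideal.Quotient.mk _ (MvPolynomial.X 0)) := rfl
  rw [map_smul, h1, hΦ, hδ, map_zero, smul_eq_mul, map_prod, map_prod] at h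
  have hu : IsUnit (∏ j : Fin (m + 1), coordFn k lam j.succ.succ ^ (k - 1)) :=
    IsUnit.prod_univ_iff.2 fun j => (isUnit_coordFn hk _).pow _
  refine (hu.mul_left_eq_zero).1 ?_
  rw [← h]
  congr 1
  refine Finset.prod_congr rfl fun j _ => ?_
  rw [map_pow, map_pow]
  rfl

/-- The rational forms are generated by `dz`: the differential of the equation for `y_j` gives
`dy_j` as a multiple of `dz`, as `y_j` is invertible. -/
theorem exists_eq_smul_D (hk : (k : K) ≠ 0) (ω : Form k lam) :
    ∃ g : FunctionField k lam, ω = g • dd (coordFn k lam 1) := by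
  suffices h : ω ∈ Submodule.span (FunctionField k lam) {dd (coordFn k lam 1)} by
    obtain ⟨g, hg⟩ := Submodule.mem_span_singleton.1 h
    exact ⟨g, hg.symm⟩
  set N := Submodule.span (FunctionField k lam) {dd (coordFn k lam 1)}
  have hz : dd (coordFn k lam 1) ∈ N := Submodule.mem_span_singleton_self _
  have hcoord : ∀ i : Fin (m + 2), dd (coordFn k lam i.succ) ∈ N := by
    refine fun i => Fin.cases hz (fun j => ?_) i
    have hu := (isUnit_coordFn (lam := lam) hk j.succ.succ).pow (k - 1)
    refine (N.smul_mem_iff_of_isUnit hu).1 ?_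
    rw [coordFn_pow_smul_D hk]
    exact N.neg_mem (N.smul_mem _ hz)
  have hpoly : ∀ f : MvPolynomial (Fin (m + 2)) K,
      dd (algebraMap (AffineRing k lam) (FunctionField k lam) (Ideal.Quotient.mk _ f)) ∈ N := by
    intro f
    induction f using MvPolynomial.induction_on with
    | C a =>
      have : algebraMap (AffineRing k lam) (FunctionField k lam)
        (Ideal.Quotient.mk _ (MvPolynomial.C a)) = algebraMap K _ a := rfl
      rw [this, Derivation.map_algebraMap]
      exact N.zero_mem
    | add p q hp hq => rw [map_add, map_add, map_add]; exact N.add_mem hp hq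
    | mul_X p i hp =>
      rw [map_mul, map_mul, Derivation.leibniz]
      exact N.add_mem (N.smul_mem _ (hcoord i)) (N.smul_mem _ hp)
  have htop : (⊤ : Submodule (FunctionField k lam) (Form k lam)) ≤ N := by
    rw [← KaehlerDifferential.span_range_map_derivation_of_isLocalization K (AffineRing k lam)
      (FunctionField k lam) (nonZeroDivisors (AffineRing k lam)), Submodule.span_le]
    rintro _ ⟨s, rfl⟩
    obtain ⟨f, rfl⟩ := Ideal.Quotient.mk_surjective s
    rw [Function.comp_apply, KaehlerDifferential.map_D]
    exact hpoly f
  exact htop trivial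

/-! ### Holomorphic forms -/

theorem hasValueAt_coordFn_mul_inverse (hk : (k : K) ≠ 0) {P : ℙ K (Fin (m + 3) → K)}
    {a : Fin (m + 3)} (ha : P.rep a ≠ 0) (i : Fin (m + 3)) :
    HasValueAt k lam P (coordFn k lam i * Ring.inverse (coordFn k lam a))
      (P.rep i / P.rep a) := by
  refine ⟨1, MvPolynomial.X i, MvPolynomial.X a, MvPolynomial.isHomogeneous_X _ _,
    MvPolynomial.isHomogeneous_X _ _, by simpa using ha, ?_, by simp⟩
  rw [MvPolynomial.aeval_X, MvPolynomial.aeval_X, mul_assoc,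
    Ring.inverse_mul_cancel _ (isUnit_coordFn hk a), mul_one]

theorem coordFn_mul_inverse_mem_localRing (hk : (k : K) ≠ 0) {P : ℙ K (Fin (m + 3) → K)}
    {a : Fin (m + 3)} (ha : P.rep a ≠ 0) (i : Fin (m + 3)) :
    coordFn k lam i * Ring.inverse (coordFn k lam a) ∈ localRing k lam P :=
  ⟨_, hasValueAt_coordFn_mul_inverse hk ha i⟩

theorem theta_eq (r : ℕ) (α : Fin (m + 1) → ℕ) :
    theta k lam r α = (coordFn k lam 1 ^ r *
      ∏ j : Fin (m + 1), Ring.inverse (coordFn k lam j.succ.succ) ^ α j) • dd (coordFn k lam 1) := by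
  rw [theta]
  congr 2
  rw [← MonoidWithZero.inverse_apply, map_prod]
  simp only [map_pow, MonoidWithZero.inverse_apply]

/-- The form `θ_{r;α}` is regular at all points with `x_1 ≠ 0`. Where some `y_j` vanishes, it is a
local parameter and `dz` is divisible by `y_j ^ (k-1)`. -/
theorem theta_mem_span_of_rep_zero_ne_zero (hk : (k : K) ≠ 0)
    (hc : ∀ j, coeff lam j ≠ 0) (hinj : Function.Injective (coeff lam)) {r : ℕ}
    {α : Fin (m + 1) → ℕ} (hα : ∀ j, α j < k) {P : ℙ K (Fin (m + 3) → K)}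
    (hP : P ∈ curve k lam) (h0 : P.rep 0 ≠ 0) :
    theta k lam r α ∈ Submodule.span (localRing k lam P) (dd '' (localRing k lam P)) := by
  have hk0 : k ≠ 0 := fun h => hk (by simp [h])
  have hreg : ∀ i, coordFn k lam i ∈ localRing k lam P := fun i => by
    have h := coordFn_mul_inverse_mem_localRing (lam := lam) hk h0 i
    rwa [coordFn_zero, Ring.inverse_one, mul_one] at h
  have hinv : ∀ i, P.rep i ≠ 0 → Ring.inverse (coordFn k lam i) ∈ localRing k lam P :=
    fun i hi => by
      have h := coordFn_mul_inverse_mem_localRing (lam := lam) hk hi 0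
      rwa [coordFn_zero, one_mul] at h
  rw [theta_eq]
  by_cases h : ∃ j : Fin (m + 1), P.rep j.succ.succ = 0
  · obtain ⟨j, hj⟩ := h
    have hPj := hP j
    rw [hj, zero_pow hk0, add_zero] at hPj
    have h1 : P.rep 1 ≠ 0 := fun h1 => by
      rw [h1, zero_pow hk0, add_zero] at hPj
      exact mul_ne_zero (hc j) (pow_ne_zero _ h0) hPj
    -- no other coordinate vanishes at `P`, because the coefficients are distinct
    have hi : ∀ i ≠ j, P.rep i.succ.succ ≠ 0 := fun i hij hi => by
      have hPi := hP i
      rw [hi, zero_pow hk0, add_zero] at hPi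
      refine hij (hinj (mul_right_cancel₀ (pow_ne_zero k h0) ?_))
      linear_combination hPi - hPj
    have hz := Ring.inverse_mul_cancel _ (isUnit_coordFn (lam := lam) hk 1)
    have hy := Ring.inverse_mul_cancel _ (isUnit_coordFn (lam := lam) hk j.succ.succ)
    have hdz : dd (coordFn k lam 1) = -((Ring.inverse (coordFn k lam 1) ^ (k - 1) *
        coordFn k lam j.succ.succ ^ (k - 1)) • dd (coordFn k lam j.succ.succ)) := by
      rw [mul_smul, coordFn_pow_smul_D hk, smul_neg, neg_neg, smul_smul, ← mul_pow, hz, one_pow,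
        one_smul]
    have hmem : -(coordFn k lam 1 ^ r * (∏ i ∈ Finset.univ.erase j,
        Ring.inverse (coordFn k lam i.succ.succ) ^ α i) *
        Ring.inverse (coordFn k lam 1) ^ (k - 1) * coordFn k lam j.succ.succ ^ (k - 1 - α j))
        ∈ localRing k lam P :=
      neg_mem (mul_mem (mul_mem (mul_mem (pow_mem (hreg _) _) (prod_mem fun i hi' =>
        pow_mem (hinv _ (hi i (Finset.ne_of_mem_erase hi'))) _)) (pow_mem (hinv _ h1) _))
        (pow_mem (hreg _) _))
    convert Submodule.smul_mem _ (⟨_, hmem⟩ : localRing k lam P)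
      (Submodule.subset_span (Set.mem_image_of_mem dd (hreg j.succ.succ))) using 1
    rw [Subalgebra.smul_def, hdz, smul_neg, smul_smul, ← neg_smul]
    congr 1
    rw [← Finset.mul_prod_erase _ _ (Finset.mem_univ j)]
    have hpow : coordFn k lam j.succ.succ ^ (k - 1)
        = coordFn k lam j.succ.succ ^ (k - 1 - α j) * coordFn k lam j.succ.succ ^ α j := by
      rw [← pow_add]
      congr 1
      have := hα j
      omega
    have hcancel : Ring.inverse (coordFn k lam j.succ.succ) ^ α j
        * coordFn k lam j.succ.succ ^ α j = 1 := by rw [← mul_pow, hy, one_pow]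
    rw [hpow]
    linear_combination (-(coordFn k lam 1 ^ r * (∏ i ∈ Finset.univ.erase j,
        Ring.inverse (coordFn k lam i.succ.succ) ^ α i) *
        Ring.inverse (coordFn k lam 1) ^ (k - 1) *
          coordFn k lam j.succ.succ ^ (k - 1 - α j))) * hcancel
  · push Not at h
    have hmem : coordFn k lam 1 ^ r *
        ∏ j : Fin (m + 1), Ring.inverse (coordFn k lam j.succ.succ) ^ α j ∈ localRing k lam P :=
      mul_mem (pow_mem (hreg _) _) (prod_mem fun j _ => pow_mem (hinv _ (h j)) _)
    exact Submodule.smul_mem _ (⟨_, hmem⟩ : localRing k lam P)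
      (Submodule.subset_span (Set.mem_image_of_mem dd (hreg 1)))

/-- The form `θ_{r;α}` is regular at the points with `x_1 = 0`, where `1 / z` is a local
parameter. -/
theorem theta_mem_span_of_rep_zero_eq_zero (hk : (k : K) ≠ 0) {r : ℕ}
    {α : Fin (m + 1) → ℕ} (hr : r + 2 ≤ ∑ j, α j) {P : ℙ K (Fin (m + 3) → K)}
    (hP : P ∈ curve k lam) (h0 : P.rep 0 = 0) :
    theta k lam r α ∈ Submodule.span (localRing k lam P) (dd '' (localRing k lam P)) := by
  have hk0 : k ≠ 0 := fun h => hk (by simp [h])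
  have h1 := (rep_zero_ne_zero_or_rep_one_ne_zero hk0 hP).resolve_left (not_not.2 h0)
  have hj : ∀ j : Fin (m + 1), P.rep j.succ.succ ≠ 0 := fun j hj => by
    have hPj := hP j
    rw [h0, hj, zero_pow hk0, mul_zero, zero_add, add_zero] at hPj
    exact pow_ne_zero _ h1 hPj
  have hz := Ring.inverse_mul_cancel _ (isUnit_coordFn (lam := lam) hk 1)
  have hw : Ring.inverse (coordFn k lam 1) ∈ localRing k lam P := by
    have h := coordFn_mul_inverse_mem_localRing (lam := lam) hk h1 0
    rwa [coordFn_zero, one_mul] at h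
  have hdz : dd (coordFn k lam 1)
      = -(coordFn k lam 1 ^ 2 • dd (Ring.inverse (coordFn k lam 1))) := by
    have h := congrArg dd hz
    rw [Derivation.leibniz, Derivation.map_one_eq_zero] at h
    have h' := congrArg (coordFn k lam 1 • ·) h
    simp only [smul_add, smul_zero, smul_smul] at h'
    rw [mul_comm, hz, one_smul, ← pow_two] at h'
    exact eq_neg_of_add_eq_zero_left h'
  have hmem : -(Ring.inverse (coordFn k lam 1) ^ (∑ j, α j - (r + 2)) *
      ∏ j : Fin (m + 1), (coordFn k lam 1 * Ring.inverse (coordFn k lam j.succ.succ)) ^ α j)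
      ∈ localRing k lam P :=
    neg_mem (mul_mem (pow_mem hw _) (prod_mem fun j _ =>
      pow_mem (coordFn_mul_inverse_mem_localRing hk (hj j) 1) _))
  rw [theta_eq]
  convert Submodule.smul_mem _ (⟨_, hmem⟩ : localRing k lam P)
    (Submodule.subset_span (Set.mem_image_of_mem dd hw)) using 1
  rw [Subalgebra.smul_def, hdz, smul_neg, smul_smul, ← neg_smul]
  congr 1
  -- the powers of `z` add up to `z ^ (r + 2)`, which is `z ^ r` times the factor `z ^ 2` of `dz`
  simp only [mul_pow, Finset.prod_mul_distrib, Finset.prod_pow_eq_pow_sum]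
  have hpow : coordFn k lam 1 ^ ∑ j, α j
      = coordFn k lam 1 ^ (∑ j, α j - (r + 2)) * coordFn k lam 1 ^ (r + 2) := by
    rw [← pow_add, Nat.sub_add_cancel hr]
  have hcancel : Ring.inverse (coordFn k lam 1) ^ (∑ j, α j - (r + 2))
      * coordFn k lam 1 ^ (∑ j, α j - (r + 2)) = 1 := by rw [← mul_pow, hz, one_pow]
  rw [hpow]
  linear_combination (coordFn k lam 1 ^ (r + 2) * ∏ j : Fin (m + 1),
    Ring.inverse (coordFn k lam j.succ.succ) ^ α j) * hcancel

theorem theta_mem_holomorphicForms (hk : (k : K) ≠ 0) (hc : ∀ j, coeff lam j ≠ 0)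
    (hinj : Function.Injective (coeff lam)) {q : ℕ × (Fin (m + 1) → ℕ)} (hq : q ∈ indexSet k m) :
    theta k lam q.1 q.2 ∈ holomorphicForms k lam := by
  rw [holomorphicForms]
  simp only [Submodule.mem_iInf, Submodule.restrictScalars_mem]
  intro P hP
  by_cases h0 : P.rep 0 = 0
  · exact theta_mem_span_of_rep_zero_eq_zero hk hq.2 hP h0
  · exact theta_mem_span_of_rep_zero_ne_zero hk hc hinj hq.1 hP h0

/-! ### The chosen forms and their map -/

theorem one_le_baseExponent (m : ℕ) : 1 ≤ baseExponent m := by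
  rcases m with _ | _ | m <;> simp [baseExponent]

/-- The chosen forms are proportional to the homogeneous coordinates. -/
theorem chosenForm_eq (hk : (k : K) ≠ 0) (i : Fin (m + 3)) :
    chosenForm k lam i
      = coordFn k lam i • theta k lam 0 fun _ : Fin (m + 1) => baseExponent m := by
  refine Fin.cases ?_ (fun i => Fin.cases ?_ (fun j => ?_) i) i
  · rw [coordFn_zero, one_smul]
    rfl
  · change theta k lam 1 _ = coordFn k lam 1 • _
    rw [theta_eq, theta_eq, smul_smul, ← mul_assoc, pow_one, pow_zero, mul_one]
    rfl
  · change theta k lam 0 (Function.update (fun _ => baseExponent m) j (baseExponent m - 1)) = _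
    rw [theta_eq, theta_eq, smul_smul]
    congr 1
    rw [← Finset.mul_prod_erase _ _ (Finset.mem_univ j), ← Finset.mul_prod_erase Finset.univ
      (fun j : Fin (m + 1) => Ring.inverse (coordFn k lam j.succ.succ) ^ baseExponent m)
      (Finset.mem_univ j), Function.update_self, Finset.prod_congr rfl (fun i hi => by
        rw [Function.update_of_ne (Finset.ne_of_mem_erase hi)])]
    have hy := Ring.inverse_mul_cancel _ (isUnit_coordFn (lam := lam) hk j.succ.succ)
    obtain ⟨e, he⟩ := Nat.exists_eq_add_of_le' (one_le_baseExponent m)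
    rw [he, Nat.add_sub_cancel, pow_succ]
    linear_combination -((Ring.inverse (coordFn k lam j.succ.succ) ^ e *
      ∏ i ∈ Finset.univ.erase j, Ring.inverse (coordFn k lam i.succ.succ) ^ (e + 1))) * hy

theorem exists_isUnit_theta_eq (hk : (k : K) ≠ 0) (r : ℕ) (α : Fin (m + 1) → ℕ) :
    ∃ h : FunctionField k lam, IsUnit h ∧ theta k lam r α = h • dd (coordFn k lam 1) :=
  ⟨_, ((isUnit_coordFn hk 1).pow r).mul
    (IsUnit.prod_univ_iff.2 fun _ => (isUnit_coordFn hk _).ringInverse.pow _), theta_eq r α⟩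

theorem eq_zero_of_smul_theta_eq_zero (hk : (k : K) ≠ 0) {α : Fin (m + 1) → ℕ}
    {g : FunctionField k lam} {r : ℕ} (hg : g • theta k lam r α = 0) : g = 0 := by
  obtain ⟨h, hu, hθ⟩ := exists_isUnit_theta_eq (lam := lam) hk r α
  rw [hθ, smul_smul] at hg
  exact hu.mul_left_eq_zero.1 (eq_zero_of_smul_D_eq_zero hk hg)

theorem linearIndependent_chosenForm (hk2 : 2 ≤ k) (hk : (k : K) ≠ 0) :
    LinearIndependent K (chosenForm k lam) := by
  have h := (linearIndependent_coordFn (lam := lam) hk2 hk).map'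
    ((LinearMap.toSpanSingleton (FunctionField k lam) (Form k lam)
      (theta k lam 0 fun _ : Fin (m + 1) => baseExponent m)).restrictScalars K)
    (LinearMap.ker_eq_bot'.2 fun g hg => eq_zero_of_smul_theta_eq_zero hk hg)
  rwa [show chosenForm k lam = _ from funext (chosenForm_eq hk)]

theorem isMapValue_self (hk : (k : K) ≠ 0) {P : ℙ K (Fin (m + 3) → K)} :
    IsMapValue k lam (chosenForm k lam) P P := by
  obtain ⟨a, ha⟩ := Function.ne_iff.1 P.rep_nonzero
  rw [Pi.zero_apply] at ha
  refine ⟨coordFn k lam a • theta k lam 0 fun _ : Fin (m + 1) => baseExponent m,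
    fun i => coordFn k lam i * Ring.inverse (coordFn k lam a), fun i => P.rep i / P.rep a,
    fun h => ?_, fun i => ?_, fun i => hasValueAt_coordFn_mul_inverse hk ha i, ?_⟩
  · have := congrFun h a
    simp [ha] at this
  · rw [chosenForm_eq hk, smul_smul, mul_assoc, Ring.inverse_mul_cancel _ (isUnit_coordFn hk a),
      mul_one]
  · conv_lhs => rw [← P.mk_rep]
    rw [Projectivization.mk_eq_mk_iff']
    refine ⟨P.rep a, funext fun i => ?_⟩
    simp [mul_div_cancel₀ _ ha]

/-- If `θ_i = f_i ω`, then `(f_1, …, f_{n+1})` is proportional to the vector of the coordinate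
functions, so that its value at `P` is proportional to the coordinates of `P`. -/
theorem eq_of_isMapValue (hk : (k : K) ≠ 0) {P Q : ℙ K (Fin (m + 3) → K)} (hP : P ∈ curve k lam)
    (h : IsMapValue k lam (chosenForm k lam) P Q) : Q = P := by
  obtain ⟨ω, f, c, hc, hθ, hf, rfl⟩ := h
  obtain ⟨g, rfl⟩ := exists_eq_smul_D hk ω
  have hprop : ∀ i, f i = f 0 * coordFn k lam i := by
    obtain ⟨h, hu, hh⟩ := exists_isUnit_theta_eq (lam := lam) hk 0
      fun _ : Fin (m + 1) => baseExponent m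
    have hi : ∀ i, coordFn k lam i * h = f i * g := fun i => by
      have := hθ i
      rw [chosenForm_eq hk, hh, smul_smul, smul_smul] at this
      exact sub_eq_zero.1 (eq_zero_of_smul_D_eq_zero hk (by rw [sub_smul, this, sub_self]))
    have h0 := hi 0
    rw [coordFn_zero, one_mul] at h0
    -- `f_1 g dz = θ_1` generates the module of rational forms, so `ω = g dz` does, too
    have hg : IsUnit g := isUnit_of_mul_isUnit_right (h0 ▸ hu)
    intro i
    refine hg.mul_left_inj.1 ?_
    linear_combination coordFn k lam i * h0 - hi i
  obtain ⟨a, ha⟩ := Function.ne_iff.1 P.rep_nonzero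
  rw [Pi.zero_apply] at ha
  have hca : ∀ i, P.rep a * c i = P.rep i * c a := by
    intro i
    obtain ⟨d, F, G, hF, hG, hG0, hFG, hci⟩ := hf i
    obtain ⟨d', F', G', hF', hG', hG0', hFG', hca⟩ := hf a
    have hhom : (MvPolynomial.X a * F * G' - MvPolynomial.X i * F' * G).IsHomogeneous
        (1 + d + d') := by
      refine (((MvPolynomial.isHomogeneous_X _ _).mul hF).mul hG').sub ?_
      rw [add_right_comm]
      exact ((MvPolynomial.isHomogeneous_X _ _).mul hF').mul hG
    have h := eval_rep_eq_zero hk hhom (by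
      simp only [map_sub, map_mul, MvPolynomial.aeval_X]
      rw [← hFG, ← hFG', hprop i, hprop a]
      ring) hP
    simp only [map_sub, map_mul, MvPolynomial.eval_X] at h
    rw [hci, hca]
    field_simp
    linear_combination h
  conv_rhs => rw [← P.mk_rep]
  rw [Projectivization.mk_eq_mk_iff']
  refine ⟨c a / P.rep a, funext fun i => ?_⟩
  rw [Pi.smul_apply, smul_eq_mul]
  field_simp
  linear_combination -hca i

theorem two_lt_of_one_lt_genus (hg : 1 < genus k (m + 2)) : 2 < (k - 1) * (m + 1) := by
  have hpos : 0 < ((k : ℚ) - 1) * ((m + 2 : ℕ) - 1) - 2 :=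
    pos_of_mul_pos_right (by rw [genus] at hg; linarith) (by positivity)
  rcases k with _ | k
  · push_cast at hpos
    nlinarith [(Nat.cast_nonneg m : (0 : ℚ) ≤ m)]
  · push_cast at hpos
    rw [Nat.add_sub_cancel]
    have : (2 : ℚ) < k * (m + 1) := by linarith
    exact_mod_cast this

/-- The hypothesis on the genus says `(k - 1) (n - 1) > 2`, which means `k > 3` for `n = 2`,
`k > 2` for `n = 3` and `k > 1` for `n ≥ 4`; so the base exponent is less than `k`. -/
theorem chosenIndex_mem_indexSet (hg : 1 < genus k (m + 2)) (i : Fin (m + 3)) :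
    chosenIndex m i ∈ indexSet k m := by
  have h := two_lt_of_one_lt_genus hg
  have he : baseExponent m < k ∧ 3 ≤ (m + 1) * baseExponent m := by
    rcases m with _ | _ | m <;> simp only [baseExponent]
    · omega
    · omega
    · refine ⟨?_, by omega⟩
      by_contra! hk
      rw [Nat.sub_eq_zero_of_le hk, zero_mul] at h
      omega
  have he1 := one_le_baseExponent m
  refine Fin.cases ⟨fun _ => he.1, ?_⟩ (fun i => Fin.cases ⟨fun _ => he.1, ?_⟩ (fun j => ?_) i) i
  · change 0 + 2 ≤ ∑ _j : Fin (m + 1), baseExponent m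
    rw [Finset.sum_const, Finset.card_univ, Fintype.card_fin, smul_eq_mul]
    omega
  · change 1 + 2 ≤ ∑ _j : Fin (m + 1), baseExponent m
    rw [Finset.sum_const, Finset.card_univ, Fintype.card_fin, smul_eq_mul]
    omega
  · refine ⟨fun i => ?_, ?_⟩
    · change Function.update (fun _ => baseExponent m) j (baseExponent m - 1) i < k
      rcases eq_or_ne i j with rfl | hij
      · rw [Function.update_self]
        omega
      · rw [Function.update_of_ne hij]
        exact he.1
    · change 0 + 2 ≤ ∑ i, Function.update (fun _ => baseExponent m) j (baseExponent m - 1) i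
      rw [Finset.sum_update_of_mem (Finset.mem_univ j), Finset.sum_const, Finset.card_sdiff,
        Finset.card_univ, Fintype.card_fin, smul_eq_mul]
      simp
      have : (m + 1) * baseExponent m = m * baseExponent m + baseExponent m := by ring
      omega

theorem coeff_ne_zero (hlam0 : ∀ i, lam i ≠ 0) (j : Fin (m + 1)) : coeff lam j ≠ 0 :=
  Fin.cases one_ne_zero hlam0 j

theorem coeff_injective (hlam1 : ∀ i, lam i ≠ 1) (hinj : Function.Injective lam) :
    Function.Injective (coeff lam) :=
  Fin.cons_injective_iff.2 ⟨fun ⟨i, hi⟩ => hlam1 i hi, hinj⟩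

end

end GenFermat

theorem mainTheorem7 {K : Type*} [Field K] [IsAlgClosed K] (p : ℕ) [CharP K p]
    (k m : ℕ) (hk : 2 ≤ k) (hp : p ≠ 0 → Nat.Coprime k p)
    (lam : Fin m → K) (hlam0 : ∀ i, lam i ≠ 0) (hlam1 : ∀ i, lam i ≠ 1)
    (hinj : Function.Injective lam) (hg : 1 < GenFermat.genus k (m + 2)) :
    (∀ i, GenFermat.chosenForm k lam i ∈ GenFermat.standardBasis k lam) ∧
    (∀ i, GenFermat.chosenForm k lam i ∈ GenFermat.holomorphicForms k lam) ∧
    LinearIndependent K (GenFermat.chosenForm k lam) ∧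
    (∀ P ∈ GenFermat.curve k lam, ∀ Q : Projectivization K (Fin (m + 3) → K),
      GenFermat.IsMapValue k lam (GenFermat.chosenForm k lam) P Q ↔ Q = P) := by
  have hkK : (k : K) ≠ 0 := by
    rw [Ne, CharP.cast_eq_zero_iff K p]
    intro hpk
    rcases eq_or_ne p 0 with rfl | hp0
    · rw [zero_dvd_iff] at hpk
      omega
    · exact CharP.char_ne_one K p (Nat.eq_one_of_dvd_coprimes (hp hp0) hpk dvd_rfl)
  have hmem := fun i => GenFermat.chosenIndex_mem_indexSet hg i
  exact ⟨fun i => ⟨_, hmem i, rfl⟩,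
    fun i => GenFermat.theta_mem_holomorphicForms hkK (GenFermat.coeff_ne_zero hlam0)
      (GenFermat.coeff_injective hlam1 hinj) (hmem i),
    GenFermat.linearIndependent_chosenForm hk hkK,
    fun P hP Q => ⟨GenFermat.eq_of_isMapValue hkK hP,
      fun h => h ▸ GenFermat.isMapValue_self hkK⟩⟩
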